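/- Let $d\ge 1$, let $\Lambda$ be a finite index set, and for each $i\in\Lambda$ let $\varphi_i:\mathbb R^d\to\mathbb R^d$ be a contracting similarity with ratio $r_i\in(0,1)$, i.e. $|\varphi_i(x)-\varphi_i(y)|=r_i|x-y|$ for all $x,y$. Let $p_i\in(0,1)$ with $\sum_{i\in\Lambda}p_i=1$, and let $\mu$ be the associated self-similar measure, i.e. the unique Borel probability measure on $\mathbb R^d$ with $\mu=\sum_{i\in\Lambda}p_i\,\mu\circ\varphi_i^{-1}$; its support is the self-similar set $F$, the unique nonempty compact set with $F=\bigcup_{i\in\Lambda}\varphi_i(F)$. Assume the open set condition: there is a nonempty open set $U\subset\mathbb R^d$ with $\varphi_i(U)\subset U$ for all $i$ and $\varphi_i(U)\cap\varphi_j(U)=\emptyset$ for $i\neq j$. Write $B(x,r)$ for the closed ball with centre $x$ and radius $r$, and define $$\dim_{\mathrm A}\mu=\inf\Big\{s>0:\ \exists C>0\ \text{such that for all } x\in F,\ 0<r<R,\quad \frac{\mu(B(x,R))}{\mu(B(x,r))}\le C\Big(\frac Rr\Big)^s\Big\},$$ and, for $x\in F$, $$\dim_{\mathrm A}(\mu,x)=\inf\Big\{s>0:\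 \exists C>0\ \text{such that for all } 0<r<R,\quad \frac{\mu(B(x,R))}{\mu(B(x,r))}\le C\Big(\frac Rr\Big)^s\Big\}$$ (with $\inf\emptyset=\infty$). If $\mu$ is doubling, i.e. there is $C\ge1$ with $\mu(B(x,2r))\le C\mu(B(x,r))$ for all $x\in F$ and $r>0$, then $$\dim_{\mathrm A}\mu=\max_{i\in\Lambda}\frac{\log p_i}{\log r_i},$$ and $\dim_{\mathrm A}(\mu,x)=\dim_{\mathrm A}\mu$ for $\mu$-almost every $x\in F$. -/

import Mathlib

open MeasureTheory

/-- `T` is a similarity with similarity ratio `c`. -/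
def IsSimilarity {X : Type*} [MetricSpace X] (T : X → X) (c : ℝ) : Prop :=
  0 < c ∧ ∀ x y : X, dist (T x) (T y) = c * dist x y

/-- The open set condition for the maps `φ i`: some nonempty open `U` contains all the images
`φ i (U)`, and these images are pairwise disjoint. -/
def OpenSetCondition {X ι : Type*} [MetricSpace X] (φ : ι → X → X) : Prop :=
  ∃ U : Set X, IsOpen U ∧ U.Nonempty ∧ (∀ i, φ i '' U ⊆ U) ∧
    ∀ i j, i ≠ j → Disjoint (φ i '' U) (φ j '' U)

/-- `μ` is a Borel probability measure with `μ = ∑ i, p i • (μ ∘ (φ i)⁻¹)`. -/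
def IsInvariantMeasure {X ι : Type*} [MetricSpace X] [MeasurableSpace X] [Fintype ι]
    (φ : ι → X → X) (p : ι → ℝ) (μ : Measure X) : Prop :=
  IsProbabilityMeasure μ ∧ μ = ∑ i, ENNReal.ofReal (p i) • μ.map (φ i)

/-- The doubling property of `μ`, regarded as a measure fully supported on its support: the centres
are the points of the support. -/
def IsDoublingMeasure {X : Type*} [MetricSpace X] [MeasurableSpace X] (μ : Measure X) : Prop :=
  ∃ C : ℝ, 1 ≤ C ∧ ∀ x ∈ μ.support, ∀ r : ℝ, 0 < r →
    μ (Metric.closedBall x (2 * r)) ≤ ENNReal.ofReal C * μ (Metric.closedBall x r)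

/-- The (global) Assouad dimension of `μ`, regarded as a measure fully supported on its support.
The infimum is taken in the extended reals, so that it is `⊤` when no exponent is admissible. -/
noncomputable def assouadDim {X : Type*} [MetricSpace X] [MeasurableSpace X]
    (μ : Measure X) : EReal :=
  sInf ((fun s : ℝ => (s : EReal)) '' {s : ℝ | 0 < s ∧ ∃ C : ℝ, 0 < C ∧
    ∀ x ∈ μ.support, ∀ r R : ℝ, 0 < r → r < R →
      μ (Metric.closedBall x R) / μ (Metric.closedBall x r) ≤ ENNReal.ofReal (C * (R / r) ^ s)})

/-- The pointwise Assouad dimension of `μ` at `x`: the constant may depend on `x`. -/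
noncomputable def pointwiseAssouadDim {X : Type*} [MetricSpace X] [MeasurableSpace X]
    (μ : Measure X) (x : X) : EReal :=
  sInf ((fun s : ℝ => (s : EReal)) '' {s : ℝ | 0 < s ∧ ∃ C : ℝ, 0 < C ∧
    ∀ r R : ℝ, 0 < r → r < R →
      μ (Metric.closedBall x R) / μ (Metric.closedBall x r) ≤ ENNReal.ofReal (C * (R / r) ^ s)})

/-! Write F for the support, and r_u, p_u for the products of ratios and probabilities along a word
u. Everything rests on the comparison of μ(B(x, A r_u)) with p_u, up to constants, for x in the
cylinder φ_u(F).

The lower bound on the ball is immediate from self-similarity once A is at least the diameter of F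
(`exists_wordWeight_le`). For the upper bound, the open set condition bounds the number of
neighbours of a cylinder. A word w with the most neighbours leaves no room for others: near
φ_{uw}(F) there is only what lies in φ_u(F) (`exists_separated_word`). A small ball centred there
has measure at most p_u, and doubling transfers this to all balls of size r_u around φ_u(F)
(`exists_real_closedBall_le`).

If x is coded by u at scale R and by uv at scale r, then μ(B(x,R))/μ(B(x,r)) is thus at most a
constant times 1/p_v, and p_v ≥ r_v^s for s the maximum of log p_i / log r_i. This gives the upper
bound (`assouadDim_le`). Conversely, almost every x has, for each n, a coding containing n copies of
a maximizing letter (`ae_exists_block`). Along these blocks the ratio has exponent exactly s, so s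
bounds the pointwise dimension from below (`le_pointwiseAssouadDim`). -/

/-! ### Words, their maps and their weights -/

/-- The composition `φ i₁ ∘ ⋯ ∘ φ iₙ` along a word. -/
def wordMap {X ι : Type*} (φ : ι → X → X) : List ι → X → X
  | [] => id
  | i :: w => φ i ∘ wordMap φ w

/-- The product `a i₁ * ⋯ * a iₙ` along a word. -/
def wordWeight {ι : Type*} (a : ι → ℝ) (w : List ι) : ℝ := (w.map a).prod

/-- Neither word is a prefix of the other. -/
def Incomparable {ι : Type*} (u v : List ι) : Prop := ¬ u <+: v ∧ ¬ v <+: u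

section Words

variable {X ι : Type*} (φ : ι → X → X) (a : ι → ℝ)

@[simp] lemma wordMap_nil : wordMap φ [] = id := rfl

@[simp] lemma wordMap_cons (i : ι) (w : List ι) : wordMap φ (i :: w) = φ i ∘ wordMap φ w := rfl

lemma wordMap_append (u v : List ι) : wordMap φ (u ++ v) = wordMap φ u ∘ wordMap φ v := by
  induction u with
  | nil => simp
  | cons i u ih => simp [ih, Function.comp_assoc]

@[simp] lemma wordWeight_nil : wordWeight a [] = 1 := by simp [wordWeight]

@[simp] lemma wordWeight_cons (i : ι) (w : List ι) :
    wordWeight a (i :: w) = a i * wordWeight a w := by simp [wordWeight]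

lemma wordWeight_append (u v : List ι) :
    wordWeight a (u ++ v) = wordWeight a u * wordWeight a v := by simp [wordWeight]

lemma wordWeight_replicate (n : ℕ) (i : ι) :
    wordWeight a (List.replicate n i) = a i ^ n := by simp [wordWeight]

variable {φ a}

lemma wordMap_image_subset {U : Set X} (hU : ∀ i, φ i '' U ⊆ U) (w : List ι) :
    wordMap φ w '' U ⊆ U := by
  induction w with
  | nil => simp
  | cons i w ih =>
    rw [wordMap_cons, Set.image_comp]
    exact (Set.image_mono ih).trans (hU i)

lemma wordWeight_pos (ha : ∀ i, 0 < a i) (w : List ι) : 0 < wordWeight a w := by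
  induction w with
  | nil => simp
  | cons i w ih => simpa using mul_pos (ha i) ih

lemma wordWeight_le_one (ha : ∀ i, 0 < a i) (ha1 : ∀ i, a i ≤ 1) (w : List ι) :
    wordWeight a w ≤ 1 := by
  induction w with
  | nil => simp
  | cons i w ih => simpa using mul_le_one₀ (ha1 i) (wordWeight_pos ha w).le ih

lemma rpow_wordWeight_le {b : ι → ℝ} {s : ℝ} (ha : ∀ i, 0 < a i) (h : ∀ i, a i ^ s ≤ b i)
    (w : List ι) : wordWeight a w ^ s ≤ wordWeight b w := by
  induction w with
  | nil => simp
  | cons i w ih =>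
    have h1 := wordWeight_pos ha w
    rw [wordWeight_cons, wordWeight_cons, Real.mul_rpow (ha i).le h1.le]
    exact mul_le_mul (h i) ih (Real.rpow_nonneg h1.le s) ((Real.rpow_nonneg (ha i).le s).trans (h i))

lemma incomparable_cons_iff (i : ι) (u v : List ι) :
    Incomparable (i :: u) (i :: v) ↔ Incomparable u v := by
  simp [Incomparable]

lemma incomparable_cons_of_ne {i j : ι} (h : i ≠ j) (u v : List ι) :
    Incomparable (i :: u) (j :: v) := by
  simp [Incomparable, h, h.symm]

lemma incomparable_append_iff (w u v : List ι) :
    Incomparable (w ++ u) (w ++ v) ↔ Incomparable u v := by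
  simp [Incomparable]

lemma Incomparable.symm {u v : List ι} (h : Incomparable u v) : Incomparable v u := ⟨h.2, h.1⟩

lemma Incomparable.ne {u v : List ι} (h : Incomparable u v) : u ≠ v := by
  rintro rfl
  exact h.1 List.prefix_rfl

lemma Incomparable.append_right {u v : List ι} (h : Incomparable u v) (w : List ι) :
    Incomparable u (v ++ w) := by
  refine ⟨fun h' => ?_, fun h' => h.2 ((List.prefix_append v w).trans h')⟩
  exact (List.prefix_or_prefix_of_prefix h' (List.prefix_append v w)).elim h.1 h.2

end Words

/-! ### Similarities and cylinders -/

section Similarity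

variable {X ι : Type*} [MetricSpace X] {φ : ι → X → X} {r : ι → ℝ}

lemma isSimilarity_wordMap (hφ : ∀ i, IsSimilarity (φ i) (r i)) (w : List ι) :
    IsSimilarity (wordMap φ w) (wordWeight r w) := by
  induction w with
  | nil => exact ⟨by simp, by simp⟩
  | cons i w ih =>
    refine ⟨wordWeight_pos (fun i => (hφ i).1) _, fun x y => ?_⟩
    simp [(hφ i).2, ih.2, mul_assoc]

lemma IsSimilarity.continuous {T : X → X} {c : ℝ} (h : IsSimilarity T c) : Continuous T :=
  (LipschitzWith.of_dist_le_mul (K := ⟨c, h.1.le⟩) fun x y => (h.2 x y).le).continuous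

lemma IsSimilarity.injective {T : X → X} {c : ℝ} (h : IsSimilarity T c) :
    Function.Injective T := by
  intro x y hxy
  have := h.2 x y
  rw [hxy, dist_self, eq_comm, mul_eq_zero, or_iff_right h.1.ne'] at this
  exact dist_eq_zero.1 this

/-- Division by `c` yields an isometry into a strictly convex space, hence an affine map; an
injective linear map in finite dimension is onto. -/
lemma IsSimilarity.surjective {E : Type*} [NormedAddCommGroup E] [InnerProductSpace ℝ E]
    [FiniteDimensional ℝ E] {T : E → E} {c : ℝ} (h : IsSimilarity T c) :
    Function.Surjective T := by
  have hi : Isometry fun x => c⁻¹ • T x := by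
    refine Isometry.of_dist_eq fun x y => ?_
    rw [dist_smul₀, h.2, Real.norm_of_nonneg (inv_nonneg.2 h.1.le), inv_mul_cancel_left₀ h.1.ne']
  have hs : Function.Surjective hi.affineIsometryOfStrictConvexSpace.linear :=
    LinearMap.injective_iff_surjective.1
      hi.affineIsometryOfStrictConvexSpace.linearIsometry.injective
  intro y
  obtain ⟨x, hx⟩ := (AffineMap.linear_surjective_iff _).1 hs (c⁻¹ • y)
  exact ⟨x, smul_right_injective E (inv_ne_zero h.1.ne') hx⟩

/-- Injectivity cancels the common prefix; at the first differing letter the images lie in disjoint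
sets `φ i '' U` and `φ j '' U`. -/
lemma disjoint_wordMap_image {U : Set X} (hφ : ∀ i, IsSimilarity (φ i) (r i))
    (hU : ∀ i, φ i '' U ⊆ U) (hd : ∀ i j, i ≠ j → Disjoint (φ i '' U) (φ j '' U))
    {u v : List ι} (h : Incomparable u v) :
    Disjoint (wordMap φ u '' U) (wordMap φ v '' U) := by
  induction u generalizing v with
  | nil => exact absurd List.nil_prefix h.1
  | cons i u ih =>
    cases v with
    | nil => exact absurd List.nil_prefix h.2
    | cons j v =>
      rw [wordMap_cons, wordMap_cons, Set.image_comp, Set.image_comp]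
      by_cases hij : i = j
      · subst hij
        exact (Set.disjoint_image_iff (hφ i).injective).2
          (ih ((incomparable_cons_iff i u v).1 h))
      · exact (hd i j hij).mono (Set.image_mono (wordMap_image_subset hU u))
          (Set.image_mono (wordMap_image_subset hU v))

variable {F : Set X}

/-- Every point of a cylinder lies in a subcylinder of any prescribed smaller scale. -/
lemma exists_cylinder {c R ρ : ℝ} (hφ : ∀ i, IsSimilarity (φ i) (r i)) (hF : F ⊆ ⋃ i, φ i '' F)
    (hc : ∀ i, c ≤ r i) (hR : R < 1) (hrR : ∀ i, r i ≤ R) (hc0 : 0 < c) (hρ : 0 < ρ)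
    (u : List ι) {x : X} (hx : x ∈ wordMap φ u '' F) :
    ∃ v, x ∈ wordMap φ (u ++ v) '' F ∧ wordWeight r (u ++ v) ≤ ρ ∧
      (v = [] ∨ c * ρ ≤ wordWeight r (u ++ v)) := by
  have hpos := wordWeight_pos fun i => (hφ i).1
  -- Here `n` bounds the number of letters still needed, each shrinking the size by at least the
  -- factor `R`.
  have key : ∀ n : ℕ, ∀ u : List ι, x ∈ wordMap φ u '' F → wordWeight r u * R ^ n ≤ ρ →
      ∃ v, x ∈ wordMap φ (u ++ v) '' F ∧ wordWeight r (u ++ v) ≤ ρ ∧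
        (v = [] ∨ c * ρ ≤ wordWeight r (u ++ v)) := by
    intro n
    induction n with
    | zero => exact fun u hx h => ⟨[], by simpa using hx, by simpa using h, .inl rfl⟩
    | succ n ih =>
      intro u hx h
      by_cases hu : wordWeight r u ≤ ρ
      · exact ⟨[], by simpa using hx, by simpa using hu, .inl rfl⟩
      obtain ⟨y, hy, rfl⟩ := hx
      obtain ⟨i, hi⟩ := Set.mem_iUnion.1 (hF hy)
      obtain ⟨z, hz, rfl⟩ := hi
      have hR0 : 0 ≤ R := (hφ i).1.le.trans (hrR i)
      have hw : wordWeight r (u ++ [i]) = wordWeight r u * r i := by simp [wordWeight_append]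
      obtain ⟨v, h1, h2, h3⟩ := ih (u ++ [i]) ⟨z, hz, by simp [wordMap_append]⟩ (by
        refine le_trans ?_ h
        rw [hw, mul_assoc, pow_succ', ← mul_assoc, ← mul_assoc]
        gcongr
        · exact (hpos u).le
        · exact hrR i)
      -- If `v = []`, the letter `i` is the one that crosses the threshold: the size was above `ρ`
      -- and drops by a factor no smaller than `c`.
      refine ⟨i :: v, by simpa using h1, by simpa using h2, .inr ?_⟩
      rcases h3 with rfl | h3
      · simp only [hw]
        rw [mul_comm]
        exact mul_le_mul (not_le.1 hu).le (hc i) hc0.le (hpos u).le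
      · simpa using h3
  obtain ⟨n, hn⟩ := exists_pow_lt_of_lt_one (div_pos hρ (hpos u)) hR
  refine key n u hx ?_
  rw [lt_div_iff₀ (hpos u)] at hn
  linarith

end Similarity

/-! ### Neighbouring cylinders and separation -/

section Neighbourhood

variable {X ι : Type*} [MetricSpace X] {φ : ι → X → X} {r : ι → ℝ} {F : Set X}

/-- A finite set of pairwise incomparable words whose cylinders have size comparable to that of
the cylinder of `w` and are close to it. -/
def IsNeighbourhood (φ : ι → X → X) (r : ι → ℝ) (F : Set X) (c : ℝ) (w : List ι)
    (S : Finset (List ι)) : Prop :=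
  (∀ v ∈ S, ∀ v' ∈ S, v ≠ v' → Incomparable v v') ∧
    ∀ v ∈ S, c * wordWeight r w ≤ wordWeight r v ∧ wordWeight r v ≤ wordWeight r w ∧
      ∃ z ∈ wordMap φ v '' F, ∃ z' ∈ wordMap φ w '' F, dist z z' ≤ wordWeight r w

/-- The map of `u` scales all sizes and distances alike, so the neighbours of `w` reappear inside
every cylinder `u`. This makes the choice of `w` below uniform in `u`. -/
lemma IsNeighbourhood.image_append [DecidableEq ι] {c : ℝ} {w : List ι} {S : Finset (List ι)}
    (hφ : ∀ i, IsSimilarity (φ i) (r i)) (h : IsNeighbourhood φ r F c w S) (u : List ι) :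
    IsNeighbourhood φ r F c (u ++ w) (S.image (u ++ ·)) := by
  have hu := wordWeight_pos (fun i => (hφ i).1) u
  refine ⟨?_, ?_⟩
  · simp only [Finset.mem_image]
    rintro _ ⟨v, hv, rfl⟩ _ ⟨v', hv', rfl⟩ hne
    exact (incomparable_append_iff u v v').2 (h.1 v hv v' hv' fun e => hne (by rw [e]))
  · simp only [Finset.mem_image]
    rintro _ ⟨v, hv, rfl⟩
    obtain ⟨h1, h2, z, ⟨y, hy, rfl⟩, z', ⟨y', hy', rfl⟩, hz⟩ := h.2 v hv
    rw [wordWeight_append, wordWeight_append]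
    refine ⟨by nlinarith, by gcongr, _, ⟨y, hy, rfl⟩, _, ⟨y', hy', rfl⟩, ?_⟩
    rw [wordMap_append, wordMap_append, Function.comp_apply, Function.comp_apply,
      (isSimilarity_wordMap hφ u).2]
    gcongr

end Neighbourhood

section Separation

variable {E ι : Type*} [NormedAddCommGroup E] [InnerProductSpace ℝ E] [FiniteDimensional ℝ E]
  {φ : ι → E → E} {r : ι → ℝ} {F : Set E}

/-- Separated subsets of a ball have bounded cardinality. -/
lemma exists_card_le_of_separated (L : ℝ) {η : ℝ} (hη : 0 < η) :
    ∃ N : ℕ, ∀ (κ : Type _) (S : Finset κ) (f : κ → E), (∀ v ∈ S, ‖f v‖ ≤ L) →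
      (∀ v ∈ S, ∀ v' ∈ S, v ≠ v' → η ≤ dist (f v) (f v')) → S.card ≤ N := by
  obtain ⟨t, -, htf, ht⟩ := (isCompact_closedBall (0 : E) L).finite_cover_balls (half_pos hη)
  refine ⟨htf.toFinset.card, fun κ S f hL hS => ?_⟩
  have hc : ∀ v ∈ S, ∃ y ∈ t, dist (f v) y < η / 2 := fun v hv => by
    simpa using ht (mem_closedBall_zero_iff.2 (hL v hv))
  choose! g hgt hg using hc
  refine Finset.card_le_card_of_injOn g (fun v hv => by simpa using hgt v hv) ?_
  intro v hv v' hv' hvv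
  by_contra hne
  have h1 := hg v hv
  have h2 := hg v' hv'
  rw [← hvv] at h2
  have h3 := dist_triangle_right (f v) (f v') (g v)
  linarith [hS v hv v' hv' hne]

/-- Under the open set condition, the number of neighbours of a cylinder is bounded. -/
lemma exists_card_neighbourhood_le (hφ : ∀ i, IsSimilarity (φ i) (r i)) (hosc : OpenSetCondition φ)
    (hFb : Bornology.IsBounded F) {c : ℝ} (hc0 : 0 < c) :
    ∃ N : ℕ, ∀ w S, IsNeighbourhood φ r F c w S → S.card ≤ N := by
  obtain ⟨U, hUo, ⟨a, ha⟩, hU, hd⟩ := hosc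
  obtain ⟨η, hη, hηU⟩ := Metric.isOpen_iff.1 hUo a ha
  obtain ⟨D, hD⟩ := hFb.subset_closedBall a
  obtain ⟨N, hN⟩ := exists_card_le_of_separated (E := E) (D + 1 + D) (mul_pos hc0 hη)
  refine ⟨N, fun w S ⟨hS, hS'⟩ => ?_⟩
  have hpos := wordWeight_pos fun i => (hφ i).1
  have hw := hpos w
  have hsim := isSimilarity_wordMap hφ
  -- The images of one point `a` of the open set, seen from `w` at scale 1, are bounded and `c *
  -- η`-separated.
  refine hN _ S (fun v => (wordWeight r w)⁻¹ • (wordMap φ v a - wordMap φ w a)) ?_ ?_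
  · intro v hv
    obtain ⟨-, h2, z, ⟨y, hy, rfl⟩, z', ⟨y', hy', rfl⟩, hz⟩ := hS' v hv
    have e1 : dist a y ≤ D := by simpa [dist_comm] using hD hy
    have e2 : dist y' a ≤ D := by simpa using hD hy'
    have hD0 : 0 ≤ D := dist_nonneg.trans e2
    rw [norm_smul, Real.norm_of_nonneg (inv_nonneg.2 hw.le), ← dist_eq_norm, inv_mul_le_iff₀ hw]
    calc dist (wordMap φ v a) (wordMap φ w a)
        ≤ dist (wordMap φ v a) (wordMap φ v y) + dist (wordMap φ v y) (wordMap φ w y')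
          + dist (wordMap φ w y') (wordMap φ w a) := dist_triangle4 _ _ _ _
      _ ≤ wordWeight r w * D + wordWeight r w + wordWeight r w * D := by
          rw [(hsim v).2, (hsim w).2]
          gcongr
      _ = wordWeight r w * (D + 1 + D) := by ring
  · intro v hv v' hv' hne
    rw [dist_smul₀, dist_sub_right, Real.norm_of_nonneg (inv_nonneg.2 hw.le), le_inv_mul_iff₀ hw]
    by_contra! hlt
    have hdis := disjoint_wordMap_image hφ hU hd (hS v hv v' hv' hne)
    -- Surjectivity writes the nearby point as the `v`-image of some `b`; closeness puts `b` in `U`,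
    -- contradicting disjointness.
    obtain ⟨b, hb⟩ := (hsim v).surjective (wordMap φ v' a)
    have hb' : dist a b < η := by
      rw [← hb, (hsim v).2, ← mul_assoc] at hlt
      have := (mul_le_mul_of_nonneg_right (hS' v hv).1 (dist_nonneg (x := a) (y := b)))
      have h3 : c * wordWeight r w * dist a b < c * wordWeight r w * η :=
        this.trans_lt (by linarith)
      exact lt_of_mul_lt_mul_left h3 (by positivity)
    refine Set.disjoint_left.1 hdis ⟨b, hηU ?_, hb⟩ ⟨a, ha, rfl⟩
    rwa [Metric.mem_ball, dist_comm]

/-- Under the open set condition, there is a word `w` such that each cylinder of a word `u ++ w`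
is far away from all cylinders of words that are incomparable to `u` and of comparable size. -/
lemma exists_separated_word {c R : ℝ} (hφ : ∀ i, IsSimilarity (φ i) (r i))
    (hosc : OpenSetCondition φ) (hFb : Bornology.IsBounded F) (hF : F ⊆ ⋃ i, φ i '' F)
    (hc : ∀ i, c ≤ r i) (hR : R < 1) (hrR : ∀ i, r i ≤ R) (hc0 : 0 < c) :
    ∃ w : List ι, ∀ u v : List ι, Incomparable u v → c * wordWeight r u ≤ wordWeight r v →
      ∀ z ∈ wordMap φ v '' F, ∀ z' ∈ wordMap φ (u ++ w) '' F,
        wordWeight r (u ++ w) < dist z z' := by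
  classical
  have hpos := wordWeight_pos fun i => (hφ i).1
  obtain ⟨N, hN⟩ := exists_card_neighbourhood_le hφ hosc hFb hc0
  let T : Set ℕ := {n | ∃ w S, IsNeighbourhood φ r F c w S ∧ S.card = n}
  have hTne : T.Nonempty := ⟨0, [], ∅, by simp [IsNeighbourhood], rfl⟩
  have hTb : BddAbove T := ⟨N, by rintro _ ⟨w, S, h, rfl⟩; exact hN w S h⟩
  -- A bounded nonempty set of naturals attains its supremum: `w` has the most neighbours. A
  -- cylinder too close to `u ++ w` would, cut down to size, be one more neighbour.
  obtain ⟨w, S, hS, hcard⟩ := Nat.sSup_mem hTne hTb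
  refine ⟨w, fun u v huv hv z hz z' hz' => ?_⟩
  by_contra! hle
  obtain ⟨t, ht, ht1, ht2⟩ := exists_cylinder hφ hF hc hR hrR hc0 (hpos (u ++ w)) v hz
  have hw1 : wordWeight r w ≤ 1 :=
    wordWeight_le_one (fun i => (hφ i).1) (fun i => (hrR i).trans hR.le) w
  have ht3 : c * wordWeight r (u ++ w) ≤ wordWeight r (v ++ t) := by
    rcases ht2 with rfl | ht2
    · rw [List.append_nil]
      refine le_trans ?_ hv
      rw [wordWeight_append]
      exact mul_le_mul_of_nonneg_left (mul_le_of_le_one_right (hpos u).le hw1) hc0.le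
    · exact ht2
  have hinc : ∀ s, Incomparable (v ++ t) (u ++ s) := fun s =>
    ((huv.append_right t).symm.append_right s)
  have hnot : v ++ t ∉ S.image (u ++ ·) := by
    rw [Finset.mem_image]
    rintro ⟨s, -, hs⟩
    exact (hinc s).ne hs.symm
  have hnew : IsNeighbourhood φ r F c (u ++ w) (insert (v ++ t) (S.image (u ++ ·))) := by
    have hS' := hS.image_append hφ u
    refine ⟨?_, ?_⟩
    · intro a ha b hb hne
      rcases Finset.mem_insert.1 ha with rfl | ha' <;> rcases Finset.mem_insert.1 hb with rfl | hb'
      · exact absurd rfl hne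
      · obtain ⟨s, -, rfl⟩ := Finset.mem_image.1 hb'
        exact hinc s
      · obtain ⟨s, -, rfl⟩ := Finset.mem_image.1 ha'
        exact (hinc s).symm
      · exact hS'.1 a ha' b hb' hne
    · intro a ha
      rcases Finset.mem_insert.1 ha with rfl | ha'
      · exact ⟨ht3, ht1, z, ht, z', hz', hle⟩
      · exact hS'.2 a ha'
  have hmax := le_csSup hTb ⟨_, _, hnew, rfl⟩
  rw [Finset.card_insert_of_notMem hnot,
    Finset.card_image_of_injective S (List.append_right_injective u)] at hmax
  omega

end Separation

/-! ### The self-similarity of the measure and its support -/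

lemma mem_support_iff_real_pos {X : Type*} [MetricSpace X] [MeasurableSpace X]
    {μ : Measure X} [IsFiniteMeasure μ] {x : X} :
    x ∈ μ.support ↔ ∀ ε > 0, 0 < μ.real (Metric.closedBall x ε) := by
  rw [Metric.nhds_basis_closedBall.mem_measureSupport]
  simp [Measure.real, ENNReal.toReal_pos_iff, measure_lt_top]

section Invariant

variable {X ι : Type*} [MetricSpace X] [MeasurableSpace X] [BorelSpace X] [Fintype ι]
  {φ : ι → X → X} {r p : ι → ℝ} {μ : Measure X}

lemma IsInvariantMeasure.real_eq_sum (hμ : IsInvariantMeasure φ p μ)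
    (hφ : ∀ i, IsSimilarity (φ i) (r i)) (hp : ∀ i, 0 < p i) {A : Set X} (hA : MeasurableSet A) :
    μ.real A = ∑ i, p i * μ.real (φ i ⁻¹' A) := by
  have := hμ.1
  have h : μ A = ∑ i, ENNReal.ofReal (p i) * μ (φ i ⁻¹' A) := by
    conv_lhs => rw [hμ.2]
    simp [Measure.finsetSum_apply, Measure.map_apply (hφ _).continuous.measurable hA]
  rw [Measure.real, h, ENNReal.toReal_sum fun i _ =>
    ENNReal.mul_ne_top ENNReal.ofReal_ne_top (measure_ne_top _ _)]
  simp [Measure.real, ENNReal.toReal_mul, (hp _).le]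

lemma IsInvariantMeasure.mul_real_preimage_le (hμ : IsInvariantMeasure φ p μ)
    (hφ : ∀ i, IsSimilarity (φ i) (r i)) (hp : ∀ i, 0 < p i) {A : Set X} (hA : MeasurableSet A)
    (w : List ι) : wordWeight p w * μ.real (wordMap φ w ⁻¹' A) ≤ μ.real A := by
  induction w generalizing A with
  | nil => simp
  | cons i w ih =>
    rw [hμ.real_eq_sum hφ hp hA, wordWeight_cons, wordMap_cons, Set.preimage_comp, mul_assoc]
    refine (mul_le_mul_of_nonneg_left (ih ((hφ i).continuous.measurable hA)) (hp i).le).trans ?_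
    exact Finset.single_le_sum (f := fun i => p i * μ.real (φ i ⁻¹' A))
      (fun j _ => mul_nonneg (hp j).le measureReal_nonneg) (Finset.mem_univ i)

lemma IsInvariantMeasure.image_support_subset (hμ : IsInvariantMeasure φ p μ)
    (hφ : ∀ i, IsSimilarity (φ i) (r i)) (hp : ∀ i, 0 < p i) (i : ι) :
    φ i '' μ.support ⊆ μ.support := by
  have := hμ.1
  rintro _ ⟨x, hx, rfl⟩
  rw [mem_support_iff_real_pos] at hx ⊢
  intro ε hε
  have h := hμ.mul_real_preimage_le hφ hp
    (Metric.isClosed_closedBall (x := φ i x) (ε := ε)).measurableSet [i]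
  refine lt_of_lt_of_le (mul_pos (wordWeight_pos hp [i]) ?_) h
  refine (hx (ε / r i) (div_pos hε (hφ i).1)).trans_le (measureReal_mono fun y hy => ?_)
  have hy' : dist y x ≤ ε / r i := hy
  simpa [(hφ i).2, mul_comm] using (le_div_iff₀ (hφ i).1).1 hy'

/-- A set that is far from all cylinders branching off from `u` has measure at most `p_u`. -/
lemma IsInvariantMeasure.real_le_wordWeight [SecondCountableTopology X] {c : ℝ}
    (hμ : IsInvariantMeasure φ p μ) (hφ : ∀ i, IsSimilarity (φ i) (r i)) (hp : ∀ i, 0 < p i)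
    (hc : ∀ i, c ≤ r i) (hr : ∀ i, r i ≤ 1) (hc0 : 0 < c)
    (u : List ι) {A : Set X} (hA : MeasurableSet A)
    (h : ∀ v, Incomparable u v → c * wordWeight r u ≤ wordWeight r v →
      Disjoint A (wordMap φ v '' μ.support)) :
    μ.real A ≤ wordWeight p u := by
  have := hμ.1
  induction u generalizing A with
  | nil => simp
  | cons i u ih =>
    have hu := wordWeight_le_one (fun i => (hφ i).1) hr u
    rw [hμ.real_eq_sum hφ hp hA, Finset.sum_eq_single i, wordWeight_cons]
    · refine mul_le_mul_of_nonneg_left (ih ((hφ i).continuous.measurable hA) fun v hv hle => ?_)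
        (hp i).le
      have hd := h (i :: v) ((incomparable_cons_iff i u v).2 hv) (by
        rw [wordWeight_cons, wordWeight_cons]
        nlinarith [(hφ i).1])
      rw [wordMap_cons, Set.image_comp] at hd
      exact Set.disjoint_left.2 fun x hx hx' => Set.disjoint_left.1 hd hx ⟨x, hx', rfl⟩
    -- The other branches contribute nothing: the cylinder of `[j]` has size at least `c`, so `A`
    -- misses it.
    · intro j _ hj
      have hd := h [j] (incomparable_cons_of_ne hj.symm u []) (by
        simp only [wordWeight_cons, wordWeight_nil, mul_one]
        refine le_trans ?_ (hc j)
        refine mul_le_of_le_one_right hc0.le ?_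
        exact mul_le_one₀ (hr i) (wordWeight_pos (fun i => (hφ i).1) u).le hu)
      have h0 : μ.real (φ j ⁻¹' A) = 0 := by
        have hsub : φ j ⁻¹' A ⊆ μ.supportᶜ := fun x hx hx' =>
          Set.disjoint_left.1 hd hx ⟨x, hx', by simp⟩
        rw [measureReal_def, measure_mono_null hsub Measure.measure_compl_support]
        rfl
      rw [h0, mul_zero]
    · simp

end Invariant

section Support

variable {E ι : Type*} [NormedAddCommGroup E] [MeasurableSpace E] [BorelSpace E]
  [Fintype ι] {φ : ι → E → E} {r p : ι → ℝ} {μ : Measure E}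

/-- The support of a self-similar measure is bounded. -/
lemma IsInvariantMeasure.isBounded_support [Nonempty ι] {R : ℝ} (hμ : IsInvariantMeasure φ p μ)
    (hφ : ∀ i, IsSimilarity (φ i) (r i)) (hp : ∀ i, 0 < p i) (hp_sum : ∑ i, p i = 1)
    (hR : R < 1) (hrR : ∀ i, r i ≤ R) : Bornology.IsBounded μ.support := by
  have := hμ.1
  obtain ⟨i₀⟩ := ‹Nonempty ι›
  have hR0 : 0 < R := (hφ i₀).1.trans_le (hrR i₀)
  obtain ⟨M, hM⟩ := (Set.finite_range fun i => ‖φ i 0‖).bddAbove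
  have hM' : ∀ i, ‖φ i 0‖ ≤ M := fun i => hM ⟨i, rfl⟩
  -- The fixed point of `t ↦ R * t + M`: every `φ i` maps the ball of radius `ρ + t / R` into that
  -- of radius `ρ + t`. Iteration shows that the ball of radius `ρ + 1` has full measure.
  set ρ := M / (1 - R) with hρ
  have hρR : R * ρ + M = ρ := by
    have : 1 - R ≠ 0 := by linarith
    rw [hρ]
    field_simp
    ring
  have hstep : ∀ t, μ.real (Metric.closedBall (0 : E) (ρ + t / R)) ≤
      μ.real (Metric.closedBall (0 : E) (ρ + t)) := by
    intro t
    rw [hμ.real_eq_sum hφ hp (Metric.isClosed_closedBall (x := (0 : E)) (ε := ρ + t)).measurableSet]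
    calc μ.real (Metric.closedBall (0 : E) (ρ + t / R))
        = ∑ i, p i * μ.real (Metric.closedBall (0 : E) (ρ + t / R)) := by
          rw [← Finset.sum_mul, hp_sum, one_mul]
      _ ≤ _ := by
          refine Finset.sum_le_sum fun i _ =>
            mul_le_mul_of_nonneg_left (measureReal_mono fun x hx => ?_) (hp i).le
          rw [Metric.mem_closedBall, dist_zero_right] at hx
          rw [Set.mem_preimage, Metric.mem_closedBall, dist_zero_right]
          have h1 : ‖φ i x - φ i 0‖ ≤ R * ‖x‖ := by
            rw [← dist_eq_norm, (hφ i).2, dist_zero_right]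
            exact mul_le_mul_of_nonneg_right (hrR i) (norm_nonneg x)
          have h2 : R * ‖x‖ ≤ R * (ρ + t / R) := mul_le_mul_of_nonneg_left hx hR0.le
          have h3 : R * (ρ + t / R) = R * ρ + t := by field_simp
          have h4 := norm_sub_norm_le (φ i x) (φ i 0)
          linarith [hM' i]
  have hiter : ∀ n : ℕ, μ.real (Metric.closedBall (0 : E) (ρ + (1 / R) ^ n)) ≤
      μ.real (Metric.closedBall (0 : E) (ρ + 1)) := by
    intro n
    induction n with
    | zero => simp
    | succ n ih =>
      refine le_trans (le_of_eq ?_) ((hstep ((1 / R) ^ n)).trans ih)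
      rw [pow_succ, mul_one_div]
  have hR1 : 1 < 1 / R := by rw [lt_div_iff₀ hR0]; linarith
  have hmono : Monotone fun n : ℕ => Metric.closedBall (0 : E) (ρ + (1 / R) ^ n) := fun m n hmn =>
    Metric.closedBall_subset_closedBall (by gcongr; exact hR1.le)
  have hU : ⋃ n : ℕ, Metric.closedBall (0 : E) (ρ + (1 / R) ^ n) = Set.univ := by
    refine Set.eq_univ_of_forall fun x => Set.mem_iUnion.2 ?_
    obtain ⟨n, hn⟩ := pow_unbounded_of_one_lt (‖x‖ - ρ) hR1
    exact ⟨n, by rw [mem_closedBall_zero_iff]; linarith⟩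
  have hlim := tendsto_measure_iUnion_atTop (μ := μ) hmono
  rw [hU, measure_univ] at hlim
  have hone : μ (Metric.closedBall (0 : E) (ρ + 1)) = 1 := by
    refine le_antisymm prob_le_one (le_of_tendsto hlim (Filter.Eventually.of_forall fun n => ?_))
    exact (ENNReal.toReal_le_toReal (measure_ne_top _ _) (measure_ne_top _ _)).1 (hiter n)
  refine (Metric.isBounded_closedBall (x := (0 : E)) (r := ρ + 1)).subset
    (Measure.support_subset_of_isClosed Metric.isClosed_closedBall ?_)
  exact (prob_compl_eq_zero_iff Metric.isClosed_closedBall.measurableSet).2 hone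

/-- The union is closed, by compactness of the support, and has full measure by invariance. -/
lemma IsInvariantMeasure.support_subset_iUnion [ProperSpace E] [Nonempty ι] {R : ℝ}
    (hμ : IsInvariantMeasure φ p μ)
    (hφ : ∀ i, IsSimilarity (φ i) (r i)) (hp : ∀ i, 0 < p i) (hp_sum : ∑ i, p i = 1)
    (hR : R < 1) (hrR : ∀ i, r i ≤ R) : μ.support ⊆ ⋃ i, φ i '' μ.support := by
  have := hμ.1
  have hcpt : IsCompact μ.support :=
    Metric.isCompact_of_isClosed_isBounded Measure.isClosed_support
      (hμ.isBounded_support hφ hp hp_sum hR hrR)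
  have hcl : IsClosed (⋃ i, φ i '' μ.support) :=
    isClosed_iUnion_of_finite fun i => (hcpt.image (hφ i).continuous).isClosed
  refine Measure.support_subset_of_isClosed hcl ?_
  have h0 : μ.real (⋃ i, φ i '' μ.support)ᶜ = 0 := by
    rw [hμ.real_eq_sum hφ hp hcl.measurableSet.compl]
    refine Finset.sum_eq_zero fun i _ => ?_
    have hsub : φ i ⁻¹' (⋃ i, φ i '' μ.support)ᶜ ⊆ μ.supportᶜ := fun x hx hx' =>
      hx (Set.mem_iUnion.2 ⟨i, x, hx', rfl⟩)
    rw [measureReal_def, measure_mono_null hsub Measure.measure_compl_support]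
    simp
  exact (measureReal_eq_zero_iff).1 h0

end Support

lemma wordMap_append_image_subset {X ι : Type*} {φ : ι → X → X} {F : Set X}
    (hF : ∀ i, φ i '' F ⊆ F) (u v : List ι) :
    wordMap φ (u ++ v) '' F ⊆ wordMap φ u '' F := by
  rw [wordMap_append, Set.image_comp]
  exact Set.image_mono (wordMap_image_subset hF v)

lemma measure_div_le_ofReal_iff {X : Type*} [MeasurableSpace X] {μ : Measure X}
    [IsFiniteMeasure μ] {A B : Set X} {K : ℝ} (hB : 0 < μ.real B)
    (hK : 0 ≤ K) : μ A / μ B ≤ ENNReal.ofReal K ↔ μ.real A ≤ K * μ.real B := by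
  rw [← ofReal_measureReal (μ := μ) (s := A), ← ofReal_measureReal (μ := μ) (s := B),
    ← ENNReal.ofReal_div_of_pos hB, ENNReal.ofReal_le_ofReal_iff hK, div_le_iff₀ hB]

/-! ### Almost sure occurrence of blocks -/

section Blocks

variable {X ι : Type*} [MetricSpace X] {φ : ι → X → X} {r p : ι → ℝ}

variable [MeasurableSpace X] [BorelSpace X] [SecondCountableTopology X] [Fintype ι]
  {μ : Measure X}

/-- Almost every point has a coding in which a given block occurs. -/
lemma IsInvariantMeasure.ae_exists_block (hμ : IsInvariantMeasure φ p μ)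
    (hφ : ∀ i, IsSimilarity (φ i) (r i)) (hp : ∀ i, 0 < p i) (hp_sum : ∑ i, p i = 1)
    (hcpt : IsCompact μ.support) (w : List ι) :
    ∀ᵐ x ∂μ, ∃ u, x ∈ wordMap φ (u ++ w) '' μ.support := by
  have := hμ.1
  set G := (⋃ u, wordMap φ (u ++ w) '' μ.support)ᶜ with hG
  have hGm : MeasurableSet G := (MeasurableSet.iUnion fun u =>
    (hcpt.image (isSimilarity_wordMap hφ _).continuous).isClosed.measurableSet).compl
  have hsub : ∀ v, wordMap φ v ⁻¹' G ⊆ G := by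
    intro v x hx hx'
    obtain ⟨u, y, hy, rfl⟩ := Set.mem_iUnion.1 hx'
    exact hx (Set.mem_iUnion.2 ⟨v ++ u, y, hy, by simp [wordMap_append]⟩)
  -- `μ.real G` is at most an average of measures of preimages, none exceeding `μ.real G`; as all
  -- weights are positive, no preimage can be smaller. For `v = w` the preimage misses the support,
  -- so `G` is null.
  have hle : ∀ v, μ.real G ≤ μ.real (wordMap φ v ⁻¹' G) := by
    classical
    intro v
    induction v using List.reverseRecOn with
    | nil => simp
    | append_singleton v i ih =>
      have hmeas := (isSimilarity_wordMap hφ v).continuous.measurable hGm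
      rw [hμ.real_eq_sum hφ hp hmeas, ← Finset.add_sum_erase _ _ (Finset.mem_univ i)] at ih
      have hrest : ∑ j ∈ Finset.univ.erase i, p j * μ.real (φ j ⁻¹' (wordMap φ v ⁻¹' G)) ≤
          (1 - p i) * μ.real G := by
        rw [← hp_sum, ← Finset.add_sum_erase _ _ (Finset.mem_univ i), add_sub_cancel_left,
          Finset.sum_mul]
        refine Finset.sum_le_sum fun j _ =>
          mul_le_mul_of_nonneg_left (measureReal_mono ?_) (hp j).le
        have := hsub (v ++ [j])
        rwa [wordMap_append, Set.preimage_comp, wordMap_cons, wordMap_nil,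
          Function.comp_id] at this
      rw [wordMap_append, Set.preimage_comp, wordMap_cons, wordMap_nil, Function.comp_id]
      have h : p i * μ.real G ≤ p i * μ.real (φ i ⁻¹' (wordMap φ v ⁻¹' G)) := by linarith
      exact le_of_mul_le_mul_left h (hp i)
  have hw : μ.real (wordMap φ w ⁻¹' G) = 0 := by
    have hsub' : wordMap φ w ⁻¹' G ⊆ μ.supportᶜ := fun x hx hx' =>
      hx (Set.mem_iUnion.2 ⟨[], x, hx', rfl⟩)
    rw [measureReal_def, measure_mono_null hsub' Measure.measure_compl_support]
    simp
  have h0 : μ G = 0 := (measureReal_eq_zero_iff).1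
    (le_antisymm ((hle w).trans hw.le) measureReal_nonneg)
  rw [ae_iff]
  refine measure_mono_null (fun x hx => ?_) h0
  simpa [hG] using hx

end Blocks

/-! ### Doubling, and ball measures against cylinder weights -/

section Doubling

variable {X : Type*} [MetricSpace X] [MeasurableSpace X] {μ : Measure X}

lemma IsDoublingMeasure.exists_real_le [IsFiniteMeasure μ] (h : IsDoublingMeasure μ) :
    ∃ C : ℝ, 1 ≤ C ∧ ∀ x ∈ μ.support, ∀ ρ : ℝ, 0 < ρ → ∀ k : ℕ,
      μ.real (Metric.closedBall x (2 ^ k * ρ)) ≤ C ^ k * μ.real (Metric.closedBall x ρ) := by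
  obtain ⟨C, hC1, hC⟩ := h
  have hC0 : 0 ≤ C := zero_le_one.trans hC1
  refine ⟨C, hC1, fun x hx ρ hρ k => ?_⟩
  induction k with
  | zero => simp
  | succ k ih =>
    have h1 := hC x hx (2 ^ k * ρ) (by positivity)
    have h2 := ENNReal.toReal_mono
      (ENNReal.mul_ne_top ENNReal.ofReal_ne_top (measure_ne_top _ _)) h1
    rw [ENNReal.toReal_mul, ENNReal.toReal_ofReal hC0] at h2
    rw [pow_succ', pow_succ', mul_assoc, mul_assoc]
    exact h2.trans (mul_le_mul_of_nonneg_left ih hC0)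

lemma pointwiseAssouadDim_le_assouadDim {x : X} (hx : x ∈ μ.support) :
    pointwiseAssouadDim μ x ≤ assouadDim μ := by
  refine sInf_le_sInf (Set.image_mono ?_)
  rintro s ⟨hs, C, hC, h⟩
  exact ⟨hs, C, hC, h x hx⟩

end Doubling

section Cylinders

variable {E ι : Type*} [NormedAddCommGroup E] [InnerProductSpace ℝ E] [FiniteDimensional ℝ E]
  [MeasurableSpace E] [BorelSpace E] [Fintype ι] {φ : ι → E → E} {r p : ι → ℝ} {μ : Measure E}

/-- Balls of the size of a cylinder have measure at least that of the cylinder. -/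
lemma IsInvariantMeasure.exists_wordWeight_le (hμ : IsInvariantMeasure φ p μ)
    (hφ : ∀ i, IsSimilarity (φ i) (r i)) (hp : ∀ i, 0 < p i)
    (hb : Bornology.IsBounded μ.support) :
    ∃ D : ℝ, 0 < D ∧ (∀ x ∈ μ.support, ∀ y ∈ μ.support, dist x y ≤ D) ∧
      ∀ u, ∀ x ∈ wordMap φ u '' μ.support, ∀ ρ, D * wordWeight r u ≤ ρ →
        wordWeight p u ≤ μ.real (Metric.closedBall x ρ) := by
  have := hμ.1
  obtain ⟨D, hD⟩ := Metric.isBounded_iff.1 hb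
  have hD' : ∀ x ∈ μ.support, ∀ y ∈ μ.support, dist x y ≤ max D 1 := fun x hx y hy =>
    (hD hx hy).trans (le_max_left _ _)
  refine ⟨max D 1, by positivity, hD', ?_⟩
  rintro u _ ⟨y, hy, rfl⟩ ρ hρ
  refine le_trans ?_ (hμ.mul_real_preimage_le hφ hp Metric.isClosed_closedBall.measurableSet u)
  have hsub : μ.support ⊆ wordMap φ u ⁻¹' Metric.closedBall (wordMap φ u y) ρ := by
    intro z hz
    rw [Set.mem_preimage, Metric.mem_closedBall, (isSimilarity_wordMap hφ u).2]
    refine le_trans ?_ hρ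
    rw [mul_comm]
    exact mul_le_mul_of_nonneg_right (hD' z hz y hy) (wordWeight_pos (fun i => (hφ i).1) u).le
  have hone : 1 ≤ μ.real (wordMap φ u ⁻¹' Metric.closedBall (wordMap φ u y) ρ) := by
    refine le_trans (le_of_eq ?_) (measureReal_mono hsub)
    rw [measureReal_def, (prob_compl_eq_zero_iff Measure.isClosed_support.measurableSet).1
      Measure.measure_compl_support]
    simp
  exact le_mul_of_one_le_right (wordWeight_pos hp u).le hone

/-- Under the doubling and the open set conditions, balls of the size of a cylinder have measure
at most a constant times that of the cylinder. -/
lemma IsInvariantMeasure.exists_real_closedBall_le {c R : ℝ} (hμ : IsInvariantMeasure φ p μ)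
    (hφ : ∀ i, IsSimilarity (φ i) (r i)) (hp : ∀ i, 0 < p i) (hosc : OpenSetCondition φ)
    (hdoub : IsDoublingMeasure μ) (hb : Bornology.IsBounded μ.support)
    (hF : μ.support ⊆ ⋃ i, φ i '' μ.support)
    (hc : ∀ i, c ≤ r i) (hR : R < 1) (hrR : ∀ i, r i ≤ R) (hc0 : 0 < c) (A : ℝ) :
    ∃ C : ℝ, 0 < C ∧ ∀ u, ∀ x ∈ wordMap φ u '' μ.support,
      μ.real (Metric.closedBall x (A * wordWeight r u)) ≤ C * wordWeight p u := by
  have := hμ.1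
  have hpos := wordWeight_pos fun i => (hφ i).1
  have hFsub := hμ.image_support_subset hφ hp
  obtain ⟨w, hw⟩ := exists_separated_word hφ hosc hb hF hc hR hrR hc0
  obtain ⟨C, hC1, hC⟩ := hdoub.exists_real_le
  obtain ⟨D, hD0, hD, -⟩ := hμ.exists_wordWeight_le hφ hp hb
  -- `k` doublings enlarge a ball of radius `r_{uw}` centred in the cylinder `u ++ w` enough to
  -- contain the ball around `x`; `k` does not depend on `u`.
  obtain ⟨k, hk⟩ := pow_unbounded_of_one_lt ((A + D) / wordWeight r w) one_lt_two
  obtain ⟨f, hf⟩ := Measure.nonempty_support (μ := μ) (IsProbabilityMeasure.ne_zero μ)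
  refine ⟨C ^ k, by positivity, ?_⟩
  rintro u _ ⟨x, hx, rfl⟩
  have hy : wordMap φ (u ++ w) f ∈ μ.support :=
    wordMap_image_subset hFsub _ ⟨f, hf, rfl⟩
  calc μ.real (Metric.closedBall (wordMap φ u x) (A * wordWeight r u))
      ≤ μ.real (Metric.closedBall (wordMap φ (u ++ w) f) (2 ^ k * wordWeight r (u ++ w))) := by
        refine measureReal_mono (Metric.closedBall_subset_closedBall' ?_)
        rw [wordMap_append, Function.comp_apply, (isSimilarity_wordMap hφ u).2, wordWeight_append]
        rw [div_lt_iff₀ (hpos w)] at hk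
        have h1 := mul_le_mul_of_nonneg_left
          (hD x hx _ (wordMap_image_subset hFsub w ⟨f, hf, rfl⟩)) (hpos u).le
        nlinarith [mul_le_mul_of_nonneg_left hk.le (hpos u).le]
    _ ≤ C ^ k * μ.real (Metric.closedBall (wordMap φ (u ++ w) f) (wordWeight r (u ++ w))) :=
        hC _ hy _ (hpos _) k
    _ ≤ C ^ k * wordWeight p u := by
        refine mul_le_mul_of_nonneg_left ?_ (by positivity)
        refine hμ.real_le_wordWeight hφ hp hc (fun i => (hrR i).trans hR.le) hc0 u
          Metric.isClosed_closedBall.measurableSet fun v hv hle => ?_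
        refine Set.disjoint_left.2 fun z hz hz' => ?_
        exact absurd (hw u v hv hle z hz' _ ⟨f, hf, rfl⟩) (not_lt.2 hz)

end Cylinders

/-! ### The two dimension bounds -/

section Bounds

variable {E ι : Type*} [NormedAddCommGroup E] [InnerProductSpace ℝ E] [FiniteDimensional ℝ E]
  [MeasurableSpace E] [BorelSpace E] [Fintype ι] {φ : ι → E → E} {r p : ι → ℝ} {μ : Measure E}

lemma IsInvariantMeasure.assouadDim_le {c R s : ℝ} (hμ : IsInvariantMeasure φ p μ)
    (hφ : ∀ i, IsSimilarity (φ i) (r i)) (hp : ∀ i, 0 < p i) (hosc : OpenSetCondition φ)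
    (hdoub : IsDoublingMeasure μ) (hb : Bornology.IsBounded μ.support)
    (hF : μ.support ⊆ ⋃ i, φ i '' μ.support)
    (hc : ∀ i, c ≤ r i) (hR : R < 1) (hrR : ∀ i, r i ≤ R) (hc0 : 0 < c) (hc1 : c ≤ 1)
    (hs : 0 < s) (hsp : ∀ i, r i ^ s ≤ p i) : assouadDim μ ≤ (s : EReal) := by
  have := hμ.1
  have hpos := wordWeight_pos fun i => (hφ i).1
  obtain ⟨D, hD0, -, hD⟩ := hμ.exists_wordWeight_le hφ hp hb
  obtain ⟨C, hC0, hC⟩ :=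
    hμ.exists_real_closedBall_le hφ hp hosc hdoub hb hF hc hR hrR hc0 (D / c)
  -- `max C 1` covers radii so large that `u` is empty, where the total mass 1 is the bound; `c ^ s`
  -- pays for the rounding of scales to cylinders.
  refine sInf_le ⟨s, ⟨hs, max C 1 * (c ^ s)⁻¹, by positivity, fun x hx ρ ρ' hρ hρρ' => ?_⟩, rfl⟩
  have hρ' := hρ.trans hρρ'
  have hball := (mem_support_iff_real_pos.1 hx) ρ hρ
  rw [measure_div_le_ofReal_iff hball (by positivity)]
  obtain ⟨u, hu, hu1, hu2⟩ := exists_cylinder hφ hF hc hR hrR hc0 (div_pos hρ' hD0) []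
    (x := x) (by simpa using hx)
  rw [List.nil_append] at hu hu1 hu2
  obtain ⟨v, hv, hv1, hv2⟩ := exists_cylinder hφ hF hc hR hrR hc0 (div_pos hρ hD0) u hu
  have hupper : μ.real (Metric.closedBall x ρ') ≤ max C 1 * wordWeight p u := by
    rcases hu2 with rfl | hu2
    · rw [wordWeight_nil, mul_one]
      exact measureReal_le_one.trans (le_max_right _ _)
    · refine (measureReal_mono (Metric.closedBall_subset_closedBall ?_)).trans
        ((hC u x hu).trans (mul_le_mul_of_nonneg_right (le_max_left _ _)
          (wordWeight_pos hp u).le))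
      rw [← mul_div_assoc, div_le_iff₀ hD0] at hu2
      rw [div_mul_eq_mul_div, le_div_iff₀ hc0]
      linarith
  have hrv : c * (ρ / ρ') ≤ wordWeight r v := by
    rcases hv2 with rfl | hv2
    · rw [wordWeight_nil]
      exact mul_le_one₀ hc1 (by positivity) ((div_le_one hρ').2 hρρ'.le)
    · rw [wordWeight_append] at hv2
      have h1 := hv2.trans (mul_le_mul_of_nonneg_right hu1 (hpos v).le)
      rw [← mul_div_assoc, div_mul_eq_mul_div, div_le_div_iff_of_pos_right hD0] at h1
      rw [← mul_div_assoc, div_le_iff₀ hρ']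
      linarith
  have hpv : (c * (ρ / ρ')) ^ s ≤ wordWeight p v :=
    (Real.rpow_le_rpow (by positivity) hrv hs.le).trans
      (rpow_wordWeight_le (fun i => (hφ i).1) hsp v)
  have hlower : wordWeight p u * (c * (ρ / ρ')) ^ s ≤ μ.real (Metric.closedBall x ρ) := by
    refine (mul_le_mul_of_nonneg_left hpv (wordWeight_pos hp u).le).trans ?_
    rw [← wordWeight_append]
    refine hD _ x hv ρ ?_
    rwa [le_div_iff₀ hD0, mul_comm] at hv1
  have hconst : (c ^ s)⁻¹ * (ρ' / ρ) ^ s * (c * (ρ / ρ')) ^ s = 1 := by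
    rw [Real.mul_rpow hc0.le (by positivity), ← inv_div ρ ρ', Real.inv_rpow (by positivity)]
    have h1 : 0 < c ^ s := by positivity
    have h2 : 0 < (ρ / ρ') ^ s := by positivity
    field_simp
  calc μ.real (Metric.closedBall x ρ') ≤ max C 1 * wordWeight p u := hupper
    _ = max C 1 * (c ^ s)⁻¹ * (ρ' / ρ) ^ s * (wordWeight p u * (c * (ρ / ρ')) ^ s) := by
        linear_combination (-(max C 1) * wordWeight p u) * hconst
    _ ≤ _ := mul_le_mul_of_nonneg_left hlower (by positivity)

lemma IsInvariantMeasure.le_pointwiseAssouadDim {c R s : ℝ} (hμ : IsInvariantMeasure φ p μ)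
    (hφ : ∀ i, IsSimilarity (φ i) (r i)) (hp : ∀ i, 0 < p i) (hosc : OpenSetCondition φ)
    (hdoub : IsDoublingMeasure μ) (hb : Bornology.IsBounded μ.support)
    (hF : μ.support ⊆ ⋃ i, φ i '' μ.support)
    (hc : ∀ i, c ≤ r i) (hR : R < 1) (hrR : ∀ i, r i ≤ R) (hc0 : 0 < c)
    {i : ι} (hi : p i = r i ^ s) {x : E}
    (hx : ∀ n, ∃ u, x ∈ wordMap φ (u ++ List.replicate n i) '' μ.support) :
    (s : EReal) ≤ pointwiseAssouadDim μ x := by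
  have := hμ.1
  have hri := (hφ i).1
  have hri1 : r i < 1 := (hrR i).trans_lt hR
  obtain ⟨D, hD0, -, hD⟩ := hμ.exists_wordWeight_le hφ hp hb
  obtain ⟨C, hC0, hC⟩ := hμ.exists_real_closedBall_le hφ hp hosc hdoub hb hF hc hR hrR hc0 D
  refine le_sInf ?_
  rintro _ ⟨t, ⟨-, K, hK, ht⟩, rfl⟩
  rw [EReal.coe_le_coe_iff]
  by_contra! hts
  have hq : p i / r i ^ t < 1 := by
    rw [hi, div_lt_one (by positivity)]
    exact Real.rpow_lt_rpow_of_exponent_gt hri hri1 hts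
  have hq0 : 0 < p i / r i ^ t := div_pos (hp i) (by positivity)
  -- The two balls have radii `D * r_u` and `D * r_u * r_i ^ (n + 1)`. The exponent `n + 1` keeps
  -- the radii distinct, as the definition requires. For `t < s` the right side tends to 0.
  have hbound : ∀ n : ℕ, 1 ≤ K * C * (p i / r i ^ t) ^ (n + 1) := by
    intro n
    obtain ⟨u, hu⟩ := hx (n + 1)
    have hw := wordWeight_pos (fun i => (hφ i).1) u
    have hwp := wordWeight_pos hp u
    have hxu := wordMap_append_image_subset (hμ.image_support_subset hφ hp) _ _ hu
    have h1 := hD u x hxu _ le_rfl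
    have h2 := hC _ x hu
    have h3 := hD _ x hu _ le_rfl
    rw [wordWeight_append, wordWeight_replicate] at h3
    rw [wordWeight_append, wordWeight_append, wordWeight_replicate, wordWeight_replicate] at h2
    rw [wordWeight_append, wordWeight_replicate] at h3
    have hball := lt_of_lt_of_le (mul_pos hwp (pow_pos (hp i) (n + 1))) h3
    have h4 := ht (D * (wordWeight r u * r i ^ (n + 1))) (D * wordWeight r u) (by positivity) (by
      rw [← mul_assoc]
      exact mul_lt_of_lt_one_right (by positivity) (pow_lt_one₀ hri.le hri1 n.succ_ne_zero))
    rw [measure_div_le_ofReal_iff hball (by positivity)] at h4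
    have hratio : (D * wordWeight r u / (D * (wordWeight r u * r i ^ (n + 1)))) ^ t =
        ((r i ^ t) ^ (n + 1))⁻¹ := by
      rw [← Real.rpow_natCast (r i ^ t), ← Real.rpow_mul hri.le, mul_comm t, Real.rpow_mul hri.le,
        Real.rpow_natCast, ← Real.inv_rpow (by positivity)]
      congr 1
      field_simp
    rw [hratio] at h4
    have h5 : wordWeight p u * 1 ≤ wordWeight p u * (K * C * (p i / r i ^ t) ^ (n + 1)) :=
      calc wordWeight p u * 1 ≤ _ := by rw [mul_one]; exact h1.trans h4
        _ ≤ K * ((r i ^ t) ^ (n + 1))⁻¹ * (C * (wordWeight p u * p i ^ (n + 1))) :=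
            mul_le_mul_of_nonneg_left h2 (by positivity)
        _ = _ := by rw [div_pow]; ring
    exact le_of_mul_le_mul_left h5 hwp
  obtain ⟨n, hn⟩ := exists_pow_lt_of_lt_one (show 0 < (K * C)⁻¹ by positivity) hq
  have h6 := hbound n
  have h7 : (p i / r i ^ t) ^ (n + 1) ≤ (p i / r i ^ t) ^ n :=
    pow_le_pow_of_le_one hq0.le hq.le n.le_succ
  have h8 : K * C * (p i / r i ^ t) ^ (n + 1) < K * C * (K * C)⁻¹ :=
    mul_lt_mul_of_pos_left (h7.trans_lt hn) (by positivity)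
  rw [mul_inv_cancel₀ (by positivity)] at h8
  linarith

end Bounds

theorem mainTheorem3 {d : ℕ} {ι : Type*} [Fintype ι] [Nonempty ι]
    (φ : ι → EuclideanSpace ℝ (Fin d) → EuclideanSpace ℝ (Fin d)) (r p : ι → ℝ)
    (hφ : ∀ i, IsSimilarity (φ i) (r i)) (hr : ∀ i, r i < 1)
    (hp : ∀ i, 0 < p i ∧ p i < 1) (hp_sum : ∑ i, p i = 1)
    (hosc : OpenSetCondition φ)
    (μ : Measure (EuclideanSpace ℝ (Fin d))) (hμ : IsInvariantMeasure φ p μ)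
    (hdoub : IsDoublingMeasure μ) :
    assouadDim μ =
        ((Finset.univ.sup' Finset.univ_nonempty
          (fun i => Real.log (p i) / Real.log (r i)) : ℝ) : EReal) ∧
      ∀ᵐ x ∂μ, pointwiseAssouadDim μ x = assouadDim μ := by
  have := hμ.1
  have hp0 : ∀ i, 0 < p i := fun i => (hp i).1
  obtain ⟨iR, hiR⟩ := Finite.exists_max r
  obtain ⟨ic, hic⟩ := Finite.exists_min r
  have hb := hμ.isBounded_support hφ hp0 hp_sum (hr iR) hiR
  have hF := hμ.support_subset_iUnion hφ hp0 hp_sum (hr iR) hiR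
  have hcpt := Metric.isCompact_of_isClosed_isBounded Measure.isClosed_support hb
  obtain ⟨i₀, -, hi₀⟩ := Finset.exists_mem_eq_sup' Finset.univ_nonempty
    (fun i => Real.log (p i) / Real.log (r i))
  set s := Finset.univ.sup' Finset.univ_nonempty (fun i => Real.log (p i) / Real.log (r i))
  have hlogr : ∀ i, Real.log (r i) < 0 := fun i => Real.log_neg (hφ i).1 (hr i)
  have hs : 0 < s := by
    rw [hi₀]
    exact div_pos_of_neg_of_neg (Real.log_neg (hp i₀).1 (hp i₀).2) (hlogr i₀)
  have hsp : ∀ i, r i ^ s ≤ p i := fun i => by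
    have h1 : Real.log (p i) / Real.log (r i) ≤ s :=
      Finset.le_sup' (fun i => Real.log (p i) / Real.log (r i)) (Finset.mem_univ i)
    rw [Real.rpow_def_of_pos (hφ i).1, ← Real.le_log_iff_exp_le (hp0 i), mul_comm]
    exact (div_le_iff_of_neg (hlogr i)).1 h1
  have hi : p i₀ = r i₀ ^ s := by
    rw [Real.rpow_def_of_pos (hφ i₀).1, hi₀, mul_div_cancel₀ _ (hlogr i₀).ne, Real.exp_log (hp0 i₀)]
  have hle : assouadDim μ ≤ (s : EReal) :=
    hμ.assouadDim_le hφ hp0 hosc hdoub hb hF hic (hr iR) hiR (hφ ic).1 (hr ic).le hs hsp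
  have hae : ∀ᵐ x ∂μ, x ∈ μ.support ∧ (s : EReal) ≤ pointwiseAssouadDim μ x := by
    filter_upwards [Measure.support_mem_ae (μ := μ), ae_all_iff.2 fun n =>
      hμ.ae_exists_block hφ hp0 hp_sum hcpt (List.replicate n i₀)] with x hx hx'
    exact ⟨hx, hμ.le_pointwiseAssouadDim hφ hp0 hosc hdoub hb hF hic (hr iR) hiR (hφ ic).1 hi hx'⟩
  -- A single typical point already bounds the global dimension from below.
  obtain ⟨x, hx, hsx⟩ := hae.exists
  have heq : assouadDim μ = (s : EReal) :=
    le_antisymm hle (hsx.trans (pointwiseAssouadDim_le_assouadDim hx))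
  refine ⟨heq, hae.mono fun y hy => ?_⟩
  exact le_antisymm (pointwiseAssouadDim_le_assouadDim hy.1) (heq.le.trans hy.2)
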